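/- Let $d, f_c \in \mathbb{N}$, let $\mathbb{T}^d = (\mathbb{R}/\mathbb{Z})^d$, and for $\ell \in \mathbb{N}$ let $\Omega_\ell = \{-\ell,\dots,\ell\}^d$ and $m_\ell = (2\ell+1)^d$. Vectors of $\mathbb{C}^{m_\ell}$ and matrices of $\mathbb{C}^{m_\ell\times m_\ell}$ are indexed by $\Omega_\ell$. Let $z = (z_k)_{k\in\Omega_{f_c}} \in \mathbb{C}^{(2f_c+1)^d}$. Consider the problem $$(\mathcal{Q}_0(z))\qquad \min_{\mu} |\mu|(\mathbb{T}^d) \quad\text{s.t.}\quad \int_{\mathbb{T}^d} e^{-2\imath\pi\langle k,x\rangle}\,d\mu(x) = z_k \quad \forall k\in\Omega_{f_c},$$ where $\mu$ ranges over the complex Borel measures on $\mathbb{T}^d$ and $|\mu|$ is the total variation of $\mu$. For $\ell \ge f_c$ consider the semidefinite program $$(\mathcal{Q}_0^{(\ell)}(z))\qquad \min_{R,\tilde z,\tau} \frac12\left(\frac{1}{m_\ell}\operatorname{Tr}(R)+\tau\right),$$ where $R\in\mathbb{C}^{m_\ell\times m_\ell}$ is Hermitian positive semidefinite, $\tilde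 z\in\mathbb{C}^{m_\ell}$ and $\tau\in\mathbb{R}$, subject to (a) $\begin{bmatrix} R & \tilde z\\ \tilde z^* & \tau\end{bmatrix}\succeq 0$; (b) $\tilde z_k = z_k$ for all $k\in\Omega_{f_c}$; (c) $R$ is a generalized Toeplitz matrix, i.e. $R_{i+k,j+k}=R_{i,j}$ for all $i,j,k\in\Omega_\ell$ with $i+k,\,j+k\in\Omega_\ell$. Then $\mathcal{Q}_0(z)$ and, for every $\ell\ge f_c$, $\mathcal{Q}_0^{(\ell)}(z)$ attain their minima; for every $\ell\ge f_c$, $$\min \mathcal{Q}_0^{(\ell)}(z) \le \min \mathcal{Q}_0^{(\ell+1)}(z)\le \min \mathcal{Q}_0(z);$$ and $$\lim_{\ell\to+\infty} \min \mathcal{Q}_0^{(\ell)}(z) = \min \mathcal{Q}_0(z).$$ -/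

import Mathlib

open MeasureTheory Filter Topology
open scoped ComplexOrder

noncomputable section

namespace SuperRes

/-- The set of multi-indices `k ∈ ℤ^d` with `|k|_∞ ≤ ℓ`. -/
abbrev box (d ℓ : ℕ) : Finset (Fin d → ℤ) :=
  Finset.Icc (fun _ => -(ℓ : ℤ)) (fun _ => (ℓ : ℤ))

/-- The index type of `ℂ^{(2ℓ+1)^d}`. -/
abbrev Idx (d ℓ : ℕ) : Type := ↥(box d ℓ)

/-- There are `(2ℓ+1)^d` multi-indices in the box. -/
theorem card_idx (d ℓ : ℕ) : Fintype.card (Idx d ℓ) = (2 * ℓ + 1) ^ d := by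
  have h : ((ℓ : ℤ) + 1 + (ℓ : ℤ)).toNat = 2 * ℓ + 1 := by omega
  simp [box, Pi.card_Icc, h]

/-- The Fourier coefficient `∫ e^{-2πi⟨k,x⟩} dμ(x)` of a complex Borel measure `μ` on the torus
`(ℝ/ℤ)^d`. -/
def measFourierCoeff {d : ℕ} (μ : ComplexMeasure (UnitAddTorus (Fin d))) (k : Fin d → ℤ) : ℂ :=
  μ.integral (fun x => UnitAddTorus.mFourier (-k) x) (ContinuousLinearMap.mul ℝ ℂ)

/-- The total variation norm `|μ|(𝕋^d)`. -/
def tvNorm {d : ℕ} (μ : ComplexMeasure (UnitAddTorus (Fin d))) : ℝ :=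
  μ.variation.real Set.univ

/-- Objective values of the feasible points of the total variation minimization problem. -/
def tvValues {d fc : ℕ} (z : Idx d fc → ℂ) : Set ℝ :=
  {v | ∃ μ : ComplexMeasure (UnitAddTorus (Fin d)),
    (∀ k : Idx d fc, measFourierCoeff μ k = z k) ∧ v = tvNorm μ}

/-- The value of the total variation minimization problem. -/
def tvMin {d fc : ℕ} (z : Idx d fc → ℂ) : ℝ := sInf (tvValues z)

/-- Generalized (multilevel) Toeplitz matrices. -/
def IsToeplitz {d ℓ : ℕ} (R : Matrix (Idx d ℓ) (Idx d ℓ) ℂ) : Prop :=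
  ∀ i j k : Idx d ℓ, ∀ (hi : i.1 + k.1 ∈ box d ℓ) (hj : j.1 + k.1 ∈ box d ℓ),
    R ⟨i.1 + k.1, hi⟩ ⟨j.1 + k.1, hj⟩ = R i j

/-- The Hermitian block matrix `[[R, w], [w*, τ]]`. -/
def blockMatrix {d ℓ : ℕ} (R : Matrix (Idx d ℓ) (Idx d ℓ) ℂ) (w : Idx d ℓ → ℂ) (τ : ℝ) :
    Matrix (Idx d ℓ ⊕ Unit) (Idx d ℓ ⊕ Unit) ℂ :=
  Matrix.fromBlocks R (Matrix.of fun i _ => w i) (Matrix.of fun _ j => star (w j))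
    (Matrix.of fun _ _ => (τ : ℂ))

/-- Feasible points of the semidefinite relaxation of order `ℓ` (used for `ℓ ≥ fc`). -/
structure SdpFeasible {d fc : ℕ} (z : Idx d fc → ℂ) (ℓ : ℕ)
    (R : Matrix (Idx d ℓ) (Idx d ℓ) ℂ) (w : Idx d ℓ → ℂ) (τ : ℝ) : Prop where
  posSemidef : R.PosSemidef
  block_posSemidef : (blockMatrix R w τ).PosSemidef
  interp : ∀ (k : Fin d → ℤ) (hc : k ∈ box d fc) (hℓ : k ∈ box d ℓ), w ⟨k, hℓ⟩ = z ⟨k, hc⟩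
  toeplitz : IsToeplitz R

/-- Objective values of the feasible points of the semidefinite relaxation of order `ℓ`. The
trace is real since `R` is Hermitian. -/
def sdpValues {d fc : ℕ} (z : Idx d fc → ℂ) (ℓ : ℕ) : Set ℝ :=
  {v | ∃ (R : Matrix (Idx d ℓ) (Idx d ℓ) ℂ) (w : Idx d ℓ → ℂ) (τ : ℝ),
    SdpFeasible z ℓ R w τ ∧ v = 1 / 2 * (1 / (2 * (ℓ : ℝ) + 1) ^ d * R.trace.re + τ)}

/-- The value of the semidefinite relaxation of order `ℓ`. -/
def sdpMin {d fc : ℕ} (z : Idx d fc → ℂ) (ℓ : ℕ) : ℝ := sInf (sdpValues z ℓ)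

end SuperRes

end

/-!
The total variation norm is dual to the supremum norm: if `μ` has Fourier coefficients `z`, then
`|∑ k, c k * z k| ≤ |μ| * ‖∑ k, c k * exp (-2πi⟨k, ·⟩)‖` for all `c`. Conversely, if this holds with
a constant `N` in place of `|μ|`, then Hahn–Banach separation and Carathéodory's theorem represent
`z` by finitely many Dirac masses of total mass `N`. Such an atomic measure yields a feasible point
with value `N` in every semidefinite program, so the programs are lower bounds.

In the other direction, let `(R, w, τ)` be feasible of order `fc + m`. The block condition gives
`|⟨c, z⟩|² ≤ τ ⟨c, R c⟩`, and by the Toeplitz property `⟨c, R c⟩` is the same for all translates of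
`c` by multi-indices of order `m`. Summing over these `(2m+1)^d` translates, Bessel's inequality
bounds the total by the trace of `R` times the squared supremum norm of the trigonometric
polynomial. Hence the objective value bounds the dual norm of `z` up to the factor
`((2m+1)/(2(fc+m)+1))^d`, which tends to `1`.
-/

noncomputable section

namespace SuperRes

open scoped Matrix

/-! ### Convex hulls of compact sets -/

section ConvexHull

variable {E : Type*} [AddCommGroup E] [Module ℝ E] [FiniteDimensional ℝ E] {K : Set E}

theorem exists_mem_stdSimplex_sum_smul_eq_of_mem_convexHull {z : E} (hz : z ∈ convexHull ℝ K) :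
    ∃ w ∈ stdSimplex ℝ (Fin (Module.finrank ℝ E + 1)),
      ∃ p : Fin (Module.finrank ℝ E + 1) → E, (∀ i, p i ∈ K) ∧ ∑ i, w i • p i = z := by
  obtain ⟨p₀, hp₀⟩ := convexHull_nonempty_iff.1 ⟨z, hz⟩
  obtain ⟨ι, _, y, w, hy, hind, hw, hw1, rfl⟩ := eq_pos_convex_span_of_mem_convexHull hz
  have hcard : Fintype.card ι ≤ Fintype.card (Fin (Module.finrank ℝ E + 1)) := by
    rw [Fintype.card_fin]
    exact hind.card_le_finrank_succ.trans (Nat.succ_le_succ (Submodule.finrank_le _))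
  obtain ⟨e⟩ := Function.Embedding.nonempty_of_card_le hcard
  have hzero : ∀ j ∉ Set.range e, Function.extend e w 0 j = 0 := fun _ =>
    Function.extend_apply' _ _ _
  refine ⟨Function.extend e w 0, ⟨fun j => ?_, ?_⟩, Function.extend e y fun _ => p₀,
    fun j => ?_, ?_⟩
  · by_cases hj : j ∈ Set.range e
    · obtain ⟨i, rfl⟩ := hj
      simpa [e.injective.extend_apply] using (hw i).le
    · exact (hzero j hj).ge
  · rw [← hw1]
    exact (Fintype.sum_of_injective e e.injective _ _ hzero
      fun i => (e.injective.extend_apply _ _ _).symm).symm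
  · by_cases hj : j ∈ Set.range e
    · obtain ⟨i, rfl⟩ := hj
      simpa [e.injective.extend_apply] using hy ⟨i, rfl⟩
    · simpa [Function.extend_apply' _ _ _ hj] using hp₀
  · refine (Fintype.sum_of_injective e e.injective _ _ (fun j hj => ?_) fun i => ?_).symm
    · simp [hzero j hj]
    · simp [e.injective.extend_apply]

theorem isCompact_convexHull [TopologicalSpace E] [ContinuousAdd E] [ContinuousSMul ℝ E]
    (hK : IsCompact K) : IsCompact (convexHull ℝ K) := by
  set n := Module.finrank ℝ E + 1
  have hcomp : IsCompact ((fun q : (Fin n → ℝ) × (Fin n → E) => ∑ i, q.1 i • q.2 i) ''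
      (stdSimplex ℝ (Fin n) ×ˢ Set.univ.pi fun _ => K)) :=
    ((isCompact_stdSimplex ℝ (Fin n)).prod (isCompact_univ_pi fun _ => hK)).image (by fun_prop)
  convert hcomp using 1
  refine Set.Subset.antisymm (fun z hz => ?_) ?_
  · obtain ⟨w, hw, p, hp, rfl⟩ := exists_mem_stdSimplex_sum_smul_eq_of_mem_convexHull hz
    exact ⟨(w, p), ⟨hw, fun i _ => hp i⟩, rfl⟩
  · rintro _ ⟨⟨w, p⟩, ⟨hw, hp⟩, rfl⟩
    exact (convex_convexHull ℝ K).sum_mem (fun i _ => hw.1 i) hw.2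
      fun i _ => subset_convexHull ℝ K (hp i trivial)

end ConvexHull

theorem mem_convexHull_of_forall_exists_re_le {𝕜 E : Type*} [RCLike 𝕜] [NormedAddCommGroup E]
    [NormedSpace ℝ E] [NormedSpace 𝕜 E] [IsScalarTower ℝ 𝕜 E] [FiniteDimensional ℝ E] {K : Set E}
    (hK : IsCompact K) {z : E}
    (h : ∀ f : StrongDual 𝕜 E, ∃ y ∈ K, RCLike.re (f z) ≤ RCLike.re (f y)) :
    z ∈ convexHull ℝ K := by
  by_contra hz
  obtain ⟨f, r, hf, hr⟩ := RCLike.geometric_hahn_banach_closed_point (𝕜 := 𝕜)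
    (convex_convexHull ℝ K) (isCompact_convexHull hK).isClosed hz
  obtain ⟨y, hy, hzy⟩ := h f
  exact (hzy.trans_lt (hf y (subset_convexHull ℝ K hy))).not_gt hr

/-! ### Complex measures -/

section ComplexMeasure

variable {X : Type*} [MeasurableSpace X]

instance isFiniteMeasure_variation (μ : ComplexMeasure X) : IsFiniteMeasure μ.variation := by
  have h : μ.variation ≤
      (ComplexMeasure.re μ).totalVariation + (ComplexMeasure.im μ).totalVariation := by
    refine VectorMeasure.variation_le_of_forall_enorm_le fun s _ => ?_
    calc ‖μ s‖ₑ ≤ ‖(μ s).re‖ₑ + ‖(μ s).im‖ₑ := by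
          rw [← ofReal_norm, ← ofReal_norm, ← ofReal_norm,
            ← ENNReal.ofReal_add (norm_nonneg _) (norm_nonneg _)]
          exact ENNReal.ofReal_le_ofReal (Complex.norm_le_abs_re_add_abs_im _)
      _ ≤ _ := add_le_add (SignedMeasure.enorm_le_totalVariation (ComplexMeasure.re μ) s)
          (SignedMeasure.enorm_le_totalVariation (ComplexMeasure.im μ) s)
  exact isFiniteMeasure_of_le _ h

theorem integral_complexMeasure_const_mul (μ : ComplexMeasure X) (c : ℂ) (f : X → ℂ) :
    μ.integral (fun x => c * f x) (ContinuousLinearMap.mul ℝ ℂ) =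
      c * μ.integral f (ContinuousLinearMap.mul ℝ ℂ) :=
  setToFun_smul (𝕜 := ℂ)
    (dominatedFinMeasAdditive_cbmApplyMeasure μ (ContinuousLinearMap.mul ℝ ℂ))
    (fun c s x => smul_mul_assoc c x (μ s)) c f

variable [TopologicalSpace X] [CompactSpace X]

theorem norm_integral_continuousMap_le (μ : ComplexMeasure X) (f : C(X, ℂ)) :
    ‖μ.integral f (ContinuousLinearMap.mul ℝ ℂ)‖ ≤ μ.variation.real Set.univ * ‖f‖ := by
  refine (VectorMeasure.norm_integral_le_of_norm_le_const
    (.of_forall f.norm_coe_le_norm)).trans_eq ?_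
  rw [ContinuousLinearMap.opNorm_mul, mul_one, mul_comm]

variable [OpensMeasurableSpace X]

theorem integrable_continuousMap (μ : ComplexMeasure X) (f : C(X, ℂ)) : μ.Integrable f :=
  Integrable.of_bound f.continuous.aestronglyMeasurable ‖f‖ (.of_forall f.norm_coe_le_norm)

theorem integral_sum_smul_continuousMap (μ : ComplexMeasure X) {α : Type*} [Fintype α]
    (c : α → ℂ) (f : α → C(X, ℂ)) :
    μ.integral (∑ i, c i • f i : C(X, ℂ)) (ContinuousLinearMap.mul ℝ ℂ) =
      ∑ i, c i * μ.integral (f i) (ContinuousLinearMap.mul ℝ ℂ) := by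
  have hcoe : ⇑(∑ i, c i • f i : C(X, ℂ)) = fun x => ∑ i, c i * f i x := by
    ext x
    simp
  rw [hcoe, VectorMeasure.integral_finsetSum _
    fun i _ => (integrable_continuousMap μ (f i)).const_mul (c i)]
  simp only [integral_complexMeasure_const_mul]

end ComplexMeasure

/-- The discrete measure `∑ i, a i • δ_{x i}`. -/
def diracSum {X α : Type*} [MeasurableSpace X] [Fintype α] (a : α → ℂ) (x : α → X) :
    ComplexMeasure X :=
  ∑ i, VectorMeasure.dirac (x i) (a i)

section DiracSum

variable {X α : Type*} [MeasurableSpace X] [Fintype α] (a : α → ℂ) (x : α → X)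

theorem variation_diracSum_le : (diracSum a x).variation.real Set.univ ≤ ∑ i, ‖a i‖ := by
  have h := VectorMeasure.variation_finsetSum_le Finset.univ
    (fun i => VectorMeasure.dirac (x i) (a i)) Set.univ
  refine ENNReal.toReal_le_of_le_ofReal (by positivity) (h.trans_eq ?_)
  rw [ENNReal.ofReal_sum_of_nonneg fun _ _ => norm_nonneg _]
  simp [Measure.finsetSum_apply]

theorem integral_diracSum [TopologicalSpace X] [OpensMeasurableSpace X] [CompactSpace X]
    [MeasurableSingletonClass X] (f : C(X, ℂ)) :
    (diracSum a x).integral f (ContinuousLinearMap.mul ℝ ℂ) = ∑ i, a i * f (x i) := by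
  rw [diracSum, VectorMeasure.integral_finsetSum_vectorMeasure
    fun i _ => integrable_continuousMap _ f]
  simp [VectorMeasure.integral_dirac, mul_comm]

end DiracSum

/-! ### Trigonometric polynomials -/

section Bessel

variable {X 𝕜 : Type*} [TopologicalSpace X] [CompactSpace X] [MeasurableSpace X] [BorelSpace X]
  [RCLike 𝕜] (ν : Measure X) [IsFiniteMeasure ν]

theorem norm_toLp_mul_le (f g : C(X, 𝕜)) :
    ‖ContinuousMap.toLp (E := 𝕜) 2 ν 𝕜 (f * g)‖ ≤ ‖f‖ * ‖ContinuousMap.toLp (E := 𝕜) 2 ν 𝕜 g‖ := by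
  refine Lp.norm_le_mul_norm_of_ae_le_mul ?_
  filter_upwards [ContinuousMap.coeFn_toLp (𝕜 := 𝕜) (p := 2) ν (f * g),
    ContinuousMap.coeFn_toLp (𝕜 := 𝕜) (p := 2) ν g] with x hfg hg
  rw [hfg, hg, ContinuousMap.mul_apply, norm_mul]
  gcongr
  exact f.norm_coe_le_norm x

theorem sum_norm_inner_toLp_mul_sq_le {ι κ : Type*} [Fintype ι] [Fintype κ] {e : ι → C(X, 𝕜)}
    {f : κ → C(X, 𝕜)} (he : Orthonormal 𝕜 fun i => ContinuousMap.toLp (E := 𝕜) 2 ν 𝕜 (e i))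
    (hf : Orthonormal 𝕜 fun i => ContinuousMap.toLp (E := 𝕜) 2 ν 𝕜 (f i)) (p : C(X, 𝕜))
    (v : ι → 𝕜) :
    ∑ i, ‖inner 𝕜 (ContinuousMap.toLp (E := 𝕜) 2 ν 𝕜 (f i))
      (ContinuousMap.toLp (E := 𝕜) 2 ν 𝕜 (p * ∑ j, v j • e j))‖ ^ 2 ≤
        ‖p‖ ^ 2 * ∑ j, ‖v j‖ ^ 2 := by
  have parseval : ‖ContinuousMap.toLp (E := 𝕜) 2 ν 𝕜 (∑ j, v j • e j)‖ ^ 2 = ∑ j, ‖v j‖ ^ 2 := by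
    rw [map_sum, ← RCLike.ofReal_inj (K := 𝕜), RCLike.ofReal_pow, ← inner_self_eq_norm_sq_to_K]
    simp only [map_smul, he.inner_sum, RCLike.conj_mul, RCLike.ofReal_sum, RCLike.ofReal_pow]
  calc _ ≤ ‖ContinuousMap.toLp (E := 𝕜) 2 ν 𝕜 (p * ∑ j, v j • e j)‖ ^ 2 :=
        hf.sum_inner_products_le _
    _ ≤ (‖p‖ * ‖ContinuousMap.toLp (E := 𝕜) 2 ν 𝕜 (∑ j, v j • e j)‖) ^ 2 := by
        gcongr
        exact norm_toLp_mul_le ν p _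
    _ = ‖p‖ ^ 2 * ∑ j, ‖v j‖ ^ 2 := by rw [mul_pow, parseval]

end Bessel

section TrigPoly

variable {ι : Type*} [Fintype ι]

theorem exists_orthonormal_mFourier (ι : Type*) [Fintype ι] :
    ∃ ν : Measure (UnitAddTorus ι), ∃ _ : IsFiniteMeasure ν, Orthonormal ℂ fun n : ι → ℤ =>
      ContinuousMap.toLp (E := ℂ) 2 ν ℂ (UnitAddTorus.mFourier n) :=
  ⟨Measure.pi fun _ => AddCircle.haarAddCircle, inferInstance, UnitAddTorus.orthonormal_mFourier⟩

variable {I S A : Finset (ι → ℤ)}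

/-- The trigonometric polynomial `x ↦ ∑ k ∈ I, c k * exp (-2πi⟨k, x⟩)`. The sign of the frequencies
is the one in the definition of Fourier coefficients, so that integrating against a measure pairs
`c` with the Fourier coefficients of that measure. -/
def trigPoly (c : I → ℂ) : C(UnitAddTorus ι, ℂ) := ∑ k, c k • UnitAddTorus.mFourier (-k.1)

theorem trigPoly_apply (c : I → ℂ) (x : UnitAddTorus ι) :
    trigPoly c x = ∑ k, c k * UnitAddTorus.mFourier (-k.1) x := by
  simp [trigPoly]

theorem sum_norm_correlation_sq_le (c : I → ℂ) (v : A → ℂ) {σ : S → I → A}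
    (hσ : ∀ s k, (σ s k).1 = k.1 + s.1) :
    ∑ s, ‖∑ k, c k * v (σ s k)‖ ^ 2 ≤ ‖trigPoly c‖ ^ 2 * ∑ a, ‖v a‖ ^ 2 := by
  obtain ⟨ν, _, ho⟩ := exists_orthonormal_mFourier ι
  have expand : trigPoly c * ∑ a, v a • UnitAddTorus.mFourier a.1 =
      ∑ k : I, ∑ a : A, (c k * v a) • UnitAddTorus.mFourier (a.1 - k.1) := by
    rw [trigPoly, Finset.sum_mul_sum]
    refine Finset.sum_congr rfl fun k _ => Finset.sum_congr rfl fun a _ => ?_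
    ext x
    simp only [ContinuousMap.mul_apply, ContinuousMap.smul_apply, smul_eq_mul, sub_eq_add_neg,
      UnitAddTorus.mFourier_add]
    ring
  have coefficient (s : S) : inner ℂ (ContinuousMap.toLp (E := ℂ) 2 ν ℂ (UnitAddTorus.mFourier s.1))
      (ContinuousMap.toLp (E := ℂ) 2 ν ℂ (trigPoly c * ∑ a, v a • UnitAddTorus.mFourier a.1)) =
        ∑ k, c k * v (σ s k) := by
    simp only [expand, map_sum, map_smul, inner_sum, inner_smul_right, orthonormal_iff_ite.mp ho]
    refine Finset.sum_congr rfl fun k _ => ?_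
    have hiff (a : A) : s.1 = a.1 - k.1 ↔ a = σ s k := by
      rw [eq_sub_iff_add_eq', Subtype.ext_iff, hσ, eq_comm]
    simp [hiff]
  simp only [← coefficient]
  exact sum_norm_inner_toLp_mul_sq_le ν (ho.comp _ Subtype.val_injective)
    (ho.comp _ Subtype.val_injective) _ _

theorem norm_coeff_le_norm_trigPoly (c : I → ℂ) (k : I) : ‖c k‖ ≤ ‖trigPoly c‖ := by
  classical
  have h := sum_norm_correlation_sq_le (S := {0}) c (Pi.single k 1)
    (σ := fun _ j => j) (by simp)
  exact le_of_sq_le_sq (by simpa [Pi.single_apply, apply_ite] using h) (norm_nonneg _)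

end TrigPoly

/-! ### Duality and atomic representations -/

section Duality

variable {ι : Type*} [Fintype ι] {I : Finset (ι → ℤ)} {z : I → ℂ} {N : ℝ}

/-- `N` bounds the norm of the functional `trigPoly c ↦ ∑ k, c k * z k` on the space of
trigonometric polynomials with frequencies in `-I`, equipped with the supremum norm. -/
def DualBound (z : I → ℂ) (N : ℝ) : Prop :=
  ∀ c : I → ℂ, ‖∑ k, c k * z k‖ ≤ N * ‖trigPoly c‖

theorem isClosed_setOf_dualBound (z : I → ℂ) : IsClosed {N | DualBound z N} := by
  simp only [DualBound, Set.ofPred_forall]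
  exact isClosed_iInter fun c => isClosed_le continuous_const (continuous_mul_const _)

theorem dualBound_sum_norm (z : I → ℂ) : DualBound z (∑ k, ‖z k‖) := by
  intro c
  rw [Finset.sum_mul]
  refine norm_sum_le_of_le _ fun k _ => ?_
  rw [norm_mul, mul_comm]
  gcongr
  exact norm_coeff_le_norm_trigPoly c k

/-- `z` is the family of Fourier coefficients, at the frequencies in `I`, of a finite combination of
Dirac masses whose amplitudes have absolute values summing to `N`. -/
def IsAtomic (z : I → ℂ) (N : ℝ) : Prop :=
  ∃ (n : ℕ) (a : Fin n → ℂ) (x : Fin n → UnitAddTorus ι),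
    ∑ i, ‖a i‖ = N ∧ ∀ k, z k = ∑ i, a i * UnitAddTorus.mFourier (-k.1) (x i)

theorem exists_norm_apply_eq_norm {X E : Type*} [TopologicalSpace X] [CompactSpace X] [Nonempty X]
    [SeminormedAddCommGroup E] (f : C(X, E)) : ∃ x, ‖f x‖ = ‖f‖ := by
  obtain ⟨x, -, hx⟩ := isCompact_univ.exists_isMaxOn Set.univ_nonempty
    f.continuous.norm.continuousOn
  exact ⟨x, (f.norm_coe_le_norm x).antisymm
    ((f.norm_le_of_nonempty).2 fun y => hx (Set.mem_univ y))⟩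

theorem exists_circle_mul_eq_norm (s : ℂ) : ∃ θ : Circle, θ * s = ‖s‖ := by
  obtain ⟨c, hc, h⟩ := RCLike.exists_norm_eq_mul_self s
  exact ⟨⟨c, mem_sphere_zero_iff_norm.2 hc⟩, h.symm⟩

/-- The vectors of Fourier coefficients of the measures `(N * θ) • δ_x` with `|θ| = 1` form a
compact set, whose support functional in the direction `c` is `N * ‖trigPoly c‖`. -/
theorem DualBound.mem_convexHull (h : DualBound z N) :
    z ∈ convexHull ℝ (Set.range fun (q : Circle × UnitAddTorus ι) (k : I) =>
      (N : ℂ) * q.1 * UnitAddTorus.mFourier (-k.1) q.2) := by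
  refine mem_convexHull_of_forall_exists_re_le (𝕜 := ℂ) (isCompact_range ?_) fun f => ?_
  · fun_prop
  classical
  obtain ⟨c, hc⟩ : ∃ c : I → ℂ, ∀ v, f v = ∑ k, c k * v k :=
    ⟨_, fun v => (f.toLinearMap.pi_apply_eq_sum_univ v).trans
      (Finset.sum_congr rfl fun _ _ => mul_comm _ _)⟩
  obtain ⟨x, hx⟩ := exists_norm_apply_eq_norm (trigPoly c)
  obtain ⟨θ, hθ⟩ := exists_circle_mul_eq_norm (trigPoly c x)
  refine ⟨_, ⟨(θ, x), rfl⟩, ?_⟩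
  have hfy : f (fun k => N * θ * UnitAddTorus.mFourier (-k.1) x) =
      ((N * ‖trigPoly c‖ : ℝ) : ℂ) := by
    rw [Complex.ofReal_mul, ← hx, ← hθ, trigPoly_apply]
    refine (hc _).trans ?_
    simp only [Finset.mul_sum]
    exact Finset.sum_congr rfl fun k _ => by ring
  calc (f z).re ≤ ‖f z‖ := Complex.re_le_norm _
    _ = ‖∑ k, c k * z k‖ := congrArg _ (hc z)
    _ ≤ N * ‖trigPoly c‖ := h c
    _ = _ := by rw [hfy]; rfl

theorem DualBound.isAtomic (h : DualBound z N) (hN : 0 ≤ N) : IsAtomic z N := by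
  obtain ⟨w, hw, p, hp, hz⟩ :=
    exists_mem_stdSimplex_sum_smul_eq_of_mem_convexHull h.mem_convexHull
  choose q hq using hp
  refine ⟨_, fun i => w i * (N * (q i).1), fun i => (q i).2, ?_, fun k => ?_⟩
  · simp only [norm_mul, Circle.norm_coe, mul_one, Complex.norm_real, Real.norm_of_nonneg hN,
      Real.norm_of_nonneg (hw.1 _), ← Finset.sum_mul, hw.2, one_mul]
  · rw [← hz, Finset.sum_apply]
    refine Finset.sum_congr rfl fun i _ => ?_
    simp [← hq, mul_assoc]

end Duality

section TotalVariation

variable {d fc : ℕ} {z : Idx d fc → ℂ} {N : ℝ}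

theorem dualBound_tvNorm {μ : ComplexMeasure (UnitAddTorus (Fin d))}
    (hμ : ∀ k : Idx d fc, measFourierCoeff μ k = z k) : DualBound z (tvNorm μ) := by
  intro c
  simp only [← hμ, measFourierCoeff]
  rw [← integral_sum_smul_continuousMap]
  exact norm_integral_continuousMap_le μ (trigPoly c)

theorem IsAtomic.exists_measure (h : IsAtomic z N) :
    ∃ μ : ComplexMeasure (UnitAddTorus (Fin d)),
      (∀ k : Idx d fc, measFourierCoeff μ k = z k) ∧ tvNorm μ ≤ N := by
  obtain ⟨n, a, x, rfl, hz⟩ := h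
  exact ⟨diracSum a x, fun k => (integral_diracSum a x _).trans (hz k).symm,
    variation_diracSum_le a x⟩

end TotalVariation

/-! ### Positive semidefinite matrices -/

section PosSemidef

variable {n 𝕜 : Type*} [RCLike 𝕜] {A : Matrix n n 𝕜}

theorem norm_sq_dotProduct_mulVec_le [Fintype n] (hA : A.PosSemidef) (x y : n → 𝕜) :
    ‖star x ⬝ᵥ A *ᵥ y‖ ^ 2 ≤
      RCLike.re (star x ⬝ᵥ A *ᵥ x) * RCLike.re (star y ⬝ᵥ A *ᵥ y) := by
  let _ := A.toSeminormedAddCommGroup hA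
  let _ := A.toInnerProductSpace hA
  have h := inner_mul_inner_self_le (𝕜 := 𝕜) x y
  rw [norm_inner_symm y x, ← sq] at h
  have hinner (u v : n → 𝕜) : inner 𝕜 u v = star u ⬝ᵥ A *ᵥ v := dotProduct_comm _ _
  simpa only [hinner] using h

theorem norm_apply_le_re_trace [Fintype n] (hA : A.PosSemidef) (i j : n) :
    ‖A i j‖ ≤ RCLike.re A.trace := by
  classical
  have hdiag (k : n) : 0 ≤ RCLike.re (A k k) := (RCLike.nonneg_iff.1 hA.diag_nonneg).1
  have hle (k : n) : RCLike.re (A k k) ≤ RCLike.re A.trace := by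
    rw [Matrix.trace, map_sum]
    exact Finset.single_le_sum (f := fun k => RCLike.re (A k k)) (fun k _ => hdiag k)
      (Finset.mem_univ k)
  have h := norm_sq_dotProduct_mulVec_le hA (Pi.single i 1) (Pi.single j 1)
  simp only [← Pi.single_star, star_one, Matrix.mulVec_single_one, single_one_dotProduct,
    Matrix.col_apply] at h
  refine le_of_sq_le_sq (h.trans ?_) ((hdiag i).trans (hle i))
  rw [sq]
  exact mul_le_mul (hle i) (hle j) (hdiag j) ((hdiag i).trans (hle i))

theorem isClosed_setOf_posSemidef [Finite n] : IsClosed {A : Matrix n n 𝕜 | A.PosSemidef} := by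
  have := Fintype.ofFinite n
  simp only [Matrix.posSemidef_iff_dotProduct_mulVec, Set.ofPred_and, Set.ofPred_forall]
  refine (isClosed_eq continuous_id.matrix_conjTranspose continuous_id).inter
    (isClosed_iInter fun y => isClosed_le continuous_const ?_)
  exact continuous_const.dotProduct (continuous_id.matrix_mulVec continuous_const)

theorem star_dotProduct_vecMulVec_star_mulVec [Fintype n] (x v : n → 𝕜) :
    star x ⬝ᵥ Matrix.vecMulVec v (star v) *ᵥ x = (‖star x ⬝ᵥ v‖ ^ 2 : ℝ) := by
  rw [Matrix.vecMulVec_mulVec, dotProduct_smul, op_smul_eq_mul, Matrix.star_dotProduct v x,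
    RCLike.star_def, RCLike.mul_conj, RCLike.ofReal_pow]

theorem sum_re_dotProduct_submatrix_mulVec_le [Fintype n] {m ι : Type*} [Fintype m] [Fintype ι]
    (hA : A.PosSemidef) {x : m → 𝕜} {σ : ι → m → n} {C : ℝ}
    (h : ∀ v : n → 𝕜, ∑ s, ‖star x ⬝ᵥ (v ∘ σ s)‖ ^ 2 ≤ C * ∑ j, ‖v j‖ ^ 2) :
    ∑ s, RCLike.re (star x ⬝ᵥ A.submatrix (σ s) (σ s) *ᵥ x) ≤ C * RCLike.re A.trace := by
  obtain ⟨r, v, rfl⟩ := Matrix.posSemidef_iff_eq_sum_vecMulVec.1 hA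
  have quadForm (s : ι) : RCLike.re (star x ⬝ᵥ (∑ i, Matrix.vecMulVec (v i) (star (v i))).submatrix
      (σ s) (σ s) *ᵥ x) = ∑ i, ‖star x ⬝ᵥ (v i ∘ σ s)‖ ^ 2 := by
    have hsub : (∑ i, Matrix.vecMulVec (v i) (star (v i))).submatrix (σ s) (σ s) =
        ∑ i, Matrix.vecMulVec (v i ∘ σ s) (star (v i ∘ σ s)) := by
      ext j k
      simp [Matrix.sum_apply, Matrix.vecMulVec_apply]
    simp only [hsub, Matrix.sum_mulVec, dotProduct_sum, star_dotProduct_vecMulVec_star_mulVec,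
      map_sum, RCLike.ofReal_re]
  have trace : RCLike.re (∑ i, Matrix.vecMulVec (v i) (star (v i))).trace =
      ∑ i, ∑ j, ‖v i j‖ ^ 2 := by
    simp [Matrix.trace_sum, Matrix.trace_vecMulVec, dotProduct, RCLike.mul_conj]
  simp only [quadForm, trace, Finset.mul_sum]
  rw [Finset.sum_comm]
  exact Finset.sum_le_sum fun i _ => (h (v i)).trans_eq (Finset.mul_sum _ _ _)

end PosSemidef

/-! ### Semidefinite programs -/

section Box

variable {d ℓ ℓ' m n : ℕ}

theorem zero_mem_box (d ℓ : ℕ) : (0 : Fin d → ℤ) ∈ box d ℓ := by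
  simp [Pi.le_def]

theorem box_mono (h : ℓ ≤ ℓ') : box d ℓ ⊆ box d ℓ' := by
  have h' : (ℓ : ℤ) ≤ ℓ' := mod_cast h
  exact Finset.Icc_subset_Icc (fun _ => neg_le_neg h') fun _ => h'

theorem add_mem_box {k s : Fin d → ℤ} (hk : k ∈ box d n) (hs : s ∈ box d m) :
    k + s ∈ box d (n + m) := by
  simp only [Finset.mem_Icc, Pi.le_def, Pi.add_apply] at hk hs ⊢
  push_cast
  exact ⟨fun i => by linarith [hk.1 i, hs.1 i], fun i => by linarith [hk.2 i, hs.2 i]⟩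

/-- The inclusion of the multi-indices of order `ℓ` into those of a larger order `ℓ'`. -/
def idxIncl (h : ℓ ≤ ℓ') (k : Idx d ℓ) : Idx d ℓ' := ⟨k.1, box_mono h k.2⟩

/-- The translate `k + s`, in the smallest box that contains all sums of elements of the boxes of
orders `n` and `m`. -/
def idxShift (s : Idx d m) (k : Idx d n) : Idx d (n + m) := ⟨k.1 + s.1, add_mem_box k.2 s.2⟩

end Box

section Toeplitz

variable {d ℓ ℓ' m n : ℕ}

theorem IsToeplitz.apply_self {R : Matrix (Idx d ℓ) (Idx d ℓ) ℂ} (hR : IsToeplitz R)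
    (k : Idx d ℓ) : R k k = R ⟨0, zero_mem_box d ℓ⟩ ⟨0, zero_mem_box d ℓ⟩ := by
  simpa using hR ⟨0, zero_mem_box d ℓ⟩ ⟨0, zero_mem_box d ℓ⟩ k (by simp) (by simp)

theorem IsToeplitz.normalized_re_trace {R : Matrix (Idx d ℓ) (Idx d ℓ) ℂ} (hR : IsToeplitz R) :
    1 / (2 * (ℓ : ℝ) + 1) ^ d * R.trace.re =
      (R ⟨0, zero_mem_box d ℓ⟩ ⟨0, zero_mem_box d ℓ⟩).re := by
  have htrace : R.trace = ((2 * (ℓ : ℝ) + 1) ^ d : ℝ) *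
      R ⟨0, zero_mem_box d ℓ⟩ ⟨0, zero_mem_box d ℓ⟩ := by
    simp only [Matrix.trace, Matrix.diag_apply, hR.apply_self, Finset.sum_const, Finset.card_univ,
      card_idx, nsmul_eq_mul]
    norm_cast
  rw [htrace, Complex.re_ofReal_mul]
  field_simp

theorem IsToeplitz.submatrix_idxIncl {R : Matrix (Idx d ℓ') (Idx d ℓ') ℂ} (hR : IsToeplitz R)
    (h : ℓ ≤ ℓ') : IsToeplitz (R.submatrix (idxIncl h) (idxIncl h)) := fun i j k _ _ =>
  hR (idxIncl h i) (idxIncl h j) (idxIncl h k) _ _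

theorem IsToeplitz.submatrix_idxShift {R : Matrix (Idx d (n + m)) (Idx d (n + m)) ℂ}
    (hR : IsToeplitz R) (s : Idx d m) :
    R.submatrix (idxShift s) (idxShift s) =
      R.submatrix (idxIncl (n.le_add_right m)) (idxIncl (n.le_add_right m)) := by
  ext j k
  exact hR (idxIncl _ j) (idxIncl _ k) (idxIncl (m.le_add_left n) s) _ _

/-- By shift invariance, the quadratic form of `R` at `x` is the average over `s` of the quadratic
forms at the translates of `x` by `s`, and on a rank one matrix these are correlations with `x`. -/
theorem IsToeplitz.mul_re_dotProduct_submatrix_mulVec_le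
    {R : Matrix (Idx d (n + m)) (Idx d (n + m)) ℂ} (hR : IsToeplitz R) (hpsd : R.PosSemidef)
    (x : Idx d n → ℂ) :
    (2 * (m : ℝ) + 1) ^ d * (star x ⬝ᵥ R.submatrix (idxIncl (n.le_add_right m))
      (idxIncl (n.le_add_right m)) *ᵥ x).re ≤ ‖trigPoly (star x)‖ ^ 2 * R.trace.re := by
  have h := sum_re_dotProduct_submatrix_mulVec_le hpsd (σ := fun s : Idx d m => idxShift s)
    fun v => sum_norm_correlation_sq_le (star x) v fun _ _ => rfl
  simp only [hR.submatrix_idxShift, Finset.sum_const, Finset.card_univ, card_idx,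
    nsmul_eq_mul] at h
  exact_mod_cast h

end Toeplitz

section BlockMatrix

variable {d ℓ : ℕ} {R : Matrix (Idx d ℓ) (Idx d ℓ) ℂ} {w : Idx d ℓ → ℂ} {τ : ℝ}

theorem norm_sq_dotProduct_le_of_posSemidef_blockMatrix (h : (blockMatrix R w τ).PosSemidef)
    (x : Idx d ℓ → ℂ) : ‖star x ⬝ᵥ w‖ ^ 2 ≤ (star x ⬝ᵥ R *ᵥ x).re * τ := by
  have hcs := norm_sq_dotProduct_mulVec_le h (Sum.elim x 0) (Sum.elim 0 1)
  simpa [blockMatrix, Matrix.mulVec, dotProduct, Fintype.sum_sum_type] using hcs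

theorem norm_blockMatrix_apply_le (h : (blockMatrix R w τ).PosSemidef) (i j : Idx d ℓ ⊕ Unit) :
    ‖blockMatrix R w τ i j‖ ≤ R.trace.re + τ := by
  refine (norm_apply_le_re_trace h i j).trans_eq ?_
  simp [blockMatrix, Matrix.trace, Fintype.sum_sum_type]

theorem nonneg_of_posSemidef_blockMatrix (h : (blockMatrix R w τ).PosSemidef) : 0 ≤ τ := by
  simpa [blockMatrix] using h.diag_nonneg (i := Sum.inr ())

end BlockMatrix

section Feasible

variable {d fc ℓ ℓ' m : ℕ} {z : Idx d fc → ℂ} {τ : ℝ}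

theorem SdpFeasible.restrict {R : Matrix (Idx d ℓ') (Idx d ℓ') ℂ} {w : Idx d ℓ' → ℂ}
    (hf : SdpFeasible z ℓ' R w τ) (h : ℓ ≤ ℓ') :
    SdpFeasible z ℓ (R.submatrix (idxIncl h) (idxIncl h)) (w ∘ idxIncl h) τ where
  posSemidef := hf.posSemidef.submatrix _
  block_posSemidef := by
    convert hf.block_posSemidef.submatrix (Sum.map (idxIncl h) id) using 1
    ext (i | i) (j | j) <;> rfl
  interp k hc hℓ := hf.interp k hc (box_mono h hℓ)
  toeplitz := hf.toeplitz.submatrix_idxIncl h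

theorem sdpValues_antitone (z : Idx d fc → ℂ) : Antitone (sdpValues z) := by
  rintro ℓ ℓ' h _ ⟨R, w, τ, hf, rfl⟩
  refine ⟨_, _, τ, hf.restrict h, ?_⟩
  rw [hf.toeplitz.normalized_re_trace, (hf.restrict h).toeplitz.normalized_re_trace]
  rfl

theorem SdpFeasible.re_trace_nonneg {R : Matrix (Idx d ℓ) (Idx d ℓ) ℂ} {w : Idx d ℓ → ℂ}
    (hf : SdpFeasible z ℓ R w τ) : 0 ≤ R.trace.re :=
  (Complex.le_def.1 hf.posSemidef.trace_nonneg).1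

theorem SdpFeasible.dualBound {R : Matrix (Idx d (fc + m)) (Idx d (fc + m)) ℂ}
    {w : Idx d (fc + m) → ℂ} (hf : SdpFeasible z (fc + m) R w τ) :
    DualBound z (1 / 2 * (1 / (2 * (m : ℝ) + 1) ^ d * R.trace.re + τ)) := by
  intro c
  have hτ := nonneg_of_posSemidef_blockMatrix hf.block_posSemidef
  have _ := hf.re_trace_nonneg
  set a := 1 / (2 * (m : ℝ) + 1) ^ d * R.trace.re
  have : 0 ≤ a := by positivity
  have hle := fc.le_add_right m
  have hw : w ∘ idxIncl hle = z := funext fun k => hf.interp k.1 k.2 _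
  have cauchySchwarz := norm_sq_dotProduct_le_of_posSemidef_blockMatrix
    (hf.restrict hle).block_posSemidef (star c)
  have fejer : (star (star c) ⬝ᵥ R.submatrix (idxIncl hle) (idxIncl hle) *ᵥ star c).re ≤
      ‖trigPoly c‖ ^ 2 * a := by
    have h := hf.toeplitz.mul_re_dotProduct_submatrix_mulVec_le hf.posSemidef (star c)
    rw [star_star c] at h ⊢
    rw [mul_left_comm, one_div, ← div_eq_inv_mul, le_div_iff₀' (by positivity)]
    exact h
  rw [hw, star_star] at cauchySchwarz
  refine le_of_sq_le_sq ?_ (by positivity)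
  calc ‖c ⬝ᵥ z‖ ^ 2 ≤ _ * τ := cauchySchwarz
    _ ≤ ‖trigPoly c‖ ^ 2 * a * τ := by rw [star_star] at fejer; gcongr
    _ ≤ (1 / 2 * (a + τ) * ‖trigPoly c‖) ^ 2 := by
        nlinarith [mul_nonneg (sq_nonneg ‖trigPoly c‖) (sq_nonneg (a - τ))]

end Feasible

section Atomic

variable {d n : ℕ} (ℓ : ℕ) (a : Fin n → ℂ) (x : Fin n → UnitAddTorus (Fin d))

/-- The Toeplitz matrix of Fourier coefficients of the positive measure `∑ i, |a i| • δ_{x i}`. -/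
def momentMatrix : Matrix (Idx d ℓ) (Idx d ℓ) ℂ :=
  Matrix.of fun j k => ∑ i, ‖a i‖ * UnitAddTorus.mFourier (k.1 - j.1) (x i)

/-- The vector of Fourier coefficients of the measure `∑ i, a i • δ_{x i}`. -/
def momentVector (k : Idx d ℓ) : ℂ := ∑ i, a i * UnitAddTorus.mFourier (-k.1) (x i)

theorem isToeplitz_momentMatrix : IsToeplitz (momentMatrix ℓ a x) := fun i j k _ _ => by
  simp [momentMatrix]

theorem posSemidef_blockMatrix_moment :
    (blockMatrix (momentMatrix ℓ a x) (momentVector ℓ a x) (∑ i, ‖a i‖)).PosSemidef := by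
  choose θ hθ using fun i => exists_circle_mul_eq_norm (a i)
  have polar (i) : (‖a i‖ : ℂ) * starRingEnd ℂ (θ i) = a i := by
    rw [← hθ, mul_right_comm, Complex.mul_conj', Circle.norm_coe, Complex.ofReal_one, one_pow,
      one_mul]
  have polar_conj (i) : (‖a i‖ : ℂ) * θ i = starRingEnd ℂ (a i) := by
    conv_rhs => rw [← polar, map_mul, Complex.conj_ofReal, Complex.conj_conj]
  set v : Fin n → Idx d ℓ ⊕ Unit → ℂ := fun i =>
    Sum.elim (fun k => UnitAddTorus.mFourier (-k.1) (x i)) fun _ => θ i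
  have rankOne : blockMatrix (momentMatrix ℓ a x) (momentVector ℓ a x) (∑ i, ‖a i‖) =
      ∑ i, (‖a i‖ : ℂ) • Matrix.vecMulVec (v i) (star (v i)) := by
    ext (j | _) (k | _)
    · simp [blockMatrix, momentMatrix, v, Matrix.sum_apply, Matrix.vecMulVec_apply,
        ← UnitAddTorus.mFourier_neg, ← UnitAddTorus.mFourier_add, sub_eq_add_neg, add_comm]
    · simp [blockMatrix, momentVector, v, Matrix.sum_apply, Matrix.vecMulVec_apply,
        mul_comm (UnitAddTorus.mFourier _ _), ← mul_assoc, polar]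
    · simp [blockMatrix, momentVector, v, Matrix.sum_apply, Matrix.vecMulVec_apply,
        ← mul_assoc, polar_conj]
    · simp [blockMatrix, v, Matrix.sum_apply, Matrix.vecMulVec_apply, Complex.mul_conj',
        Circle.norm_coe]
  rw [rankOne]
  refine Matrix.posSemidef_sum _ fun i _ =>
    (Matrix.posSemidef_vecMulVec_self_star (v i)).smul ?_
  exact_mod_cast norm_nonneg (a i)

theorem IsAtomic.mem_sdpValues {fc : ℕ} {z : Idx d fc → ℂ} {N : ℝ} (h : IsAtomic z N) (ℓ : ℕ) :
    N ∈ sdpValues z ℓ := by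
  obtain ⟨n, a, x, rfl, hz⟩ := h
  have hpsd := posSemidef_blockMatrix_moment ℓ a x
  have htoep := isToeplitz_momentMatrix ℓ a x
  refine ⟨momentMatrix ℓ a x, momentVector ℓ a x, ∑ i, ‖a i‖,
    ⟨hpsd.submatrix Sum.inl, hpsd, fun k hc _ => (hz ⟨k, hc⟩).symm, htoep⟩, ?_⟩
  rw [htoep.normalized_re_trace]
  have hdiag : momentMatrix ℓ a x ⟨0, zero_mem_box d ℓ⟩ ⟨0, zero_mem_box d ℓ⟩ =
      ((∑ i, ‖a i‖ : ℝ) : ℂ) := by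
    simp [momentMatrix, UnitAddTorus.mFourier_zero]
  rw [hdiag, Complex.ofReal_re]
  ring

end Atomic

/-! ### Attainment -/

section Attainment

open scoped Matrix.Norms.Elementwise

variable {d fc ℓ : ℕ} {z : Idx d fc → ℂ}

/-- The objective function of the semidefinite program of order `ℓ`, as a function of the
triple `(R, w, τ)`. -/
def sdpObjective (q : Matrix (Idx d ℓ) (Idx d ℓ) ℂ × (Idx d ℓ → ℂ) × ℝ) : ℝ :=
  1 / 2 * (1 / (2 * (ℓ : ℝ) + 1) ^ d * q.1.trace.re + q.2.2)

theorem continuous_sdpObjective : Continuous (sdpObjective (d := d) (ℓ := ℓ)) := by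
  have htrace : Continuous fun q : Matrix (Idx d ℓ) (Idx d ℓ) ℂ × (Idx d ℓ → ℂ) × ℝ =>
      q.1.trace.re := Complex.continuous_re.comp continuous_fst.matrix_trace
  exact ((htrace.const_mul _).add continuous_snd.snd).const_mul _

theorem continuous_blockMatrix :
    Continuous fun q : Matrix (Idx d ℓ) (Idx d ℓ) ℂ × (Idx d ℓ → ℂ) × ℝ =>
      blockMatrix q.1 q.2.1 q.2.2 := by
  refine continuous_fst.matrix_fromBlocks ?_ ?_ ?_ <;>
    exact continuous_matrix fun _ _ => by simp only [Matrix.of_apply]; fun_prop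

theorem isClosed_setOf_isToeplitz :
    IsClosed {R : Matrix (Idx d ℓ) (Idx d ℓ) ℂ | IsToeplitz R} := by
  simp only [IsToeplitz, Set.ofPred_forall]
  exact isClosed_iInter fun i => isClosed_iInter fun j => isClosed_iInter fun k =>
    isClosed_iInter fun hi => isClosed_iInter fun hj =>
      isClosed_eq (continuous_id.matrix_elem _ _) (continuous_id.matrix_elem _ _)

theorem isClosed_setOf_sdpFeasible (z : Idx d fc → ℂ) (ℓ : ℕ) :
    IsClosed {q : Matrix (Idx d ℓ) (Idx d ℓ) ℂ × (Idx d ℓ → ℂ) × ℝ |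
      SdpFeasible z ℓ q.1 q.2.1 q.2.2} := by
  have hinterp : IsClosed {w : Idx d ℓ → ℂ | ∀ (k : Fin d → ℤ) (hc : k ∈ box d fc)
      (hℓ : k ∈ box d ℓ), w ⟨k, hℓ⟩ = z ⟨k, hc⟩} := by
    simp only [Set.ofPred_forall]
    exact isClosed_iInter fun k => isClosed_iInter fun hc => isClosed_iInter fun hℓ =>
      isClosed_eq (continuous_apply _) continuous_const
  convert (isClosed_setOf_posSemidef.preimage continuous_fst).inter
    ((isClosed_setOf_posSemidef.preimage continuous_blockMatrix).inter
      ((hinterp.preimage continuous_snd.fst).inter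
        (isClosed_setOf_isToeplitz.preimage continuous_fst))) using 1
  ext q
  exact ⟨fun h => ⟨h.1, h.2, h.3, h.4⟩, fun ⟨h₁, h₂, h₃, h₄⟩ => ⟨h₁, h₂, h₃, h₄⟩⟩

theorem SdpFeasible.norm_le {q : Matrix (Idx d ℓ) (Idx d ℓ) ℂ × (Idx d ℓ → ℂ) × ℝ}
    (hq : SdpFeasible z ℓ q.1 q.2.1 q.2.2) :
    ‖q‖ ≤ 2 * (2 * (ℓ : ℝ) + 1) ^ d * sdpObjective q := by
  obtain ⟨R, w, τ⟩ := q
  have hτ : 0 ≤ τ := nonneg_of_posSemidef_blockMatrix hq.block_posSemidef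
  have htrace : 0 ≤ R.trace.re := hq.re_trace_nonneg
  have hentry := norm_blockMatrix_apply_le hq.block_posSemidef
  have hblock : ‖(R, w, τ)‖ ≤ R.trace.re + τ := by
    refine max_le ((Matrix.norm_le_iff (by positivity)).2 fun i j => ?_)
      (max_le ((pi_norm_le_iff_of_nonneg (by positivity)).2 fun i => ?_) ?_)
    · exact hentry (Sum.inl i) (Sum.inl j)
    · exact hentry (Sum.inl i) (Sum.inr ())
    · rw [Real.norm_of_nonneg hτ]
      exact le_add_of_nonneg_left htrace
  calc ‖(R, w, τ)‖ ≤ R.trace.re + τ := hblock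
    _ ≤ R.trace.re + (2 * (ℓ : ℝ) + 1) ^ d * τ := by
        gcongr
        exact le_mul_of_one_le_left hτ (one_le_pow₀ (by linarith [ℓ.cast_nonneg (α := ℝ)]))
    _ = 2 * (2 * (ℓ : ℝ) + 1) ^ d * sdpObjective (R, w, τ) := by
        rw [sdpObjective]
        field_simp

theorem exists_isMinOn_sdpObjective (h : (sdpValues z ℓ).Nonempty) :
    ∃ q : Matrix (Idx d ℓ) (Idx d ℓ) ℂ × (Idx d ℓ → ℂ) × ℝ, SdpFeasible z ℓ q.1 q.2.1 q.2.2 ∧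
      IsMinOn sdpObjective {q | SdpFeasible z ℓ q.1 q.2.1 q.2.2} q := by
  obtain ⟨_, R, w, τ, hf, rfl⟩ := h
  refine continuous_sdpObjective.continuousOn.exists_isMinOn' (isClosed_setOf_sdpFeasible z ℓ)
    (x₀ := (R, w, τ)) hf ?_
  refine eventually_inf_principal.2 ?_
  filter_upwards [(tendsto_norm_cocompact_atTop).eventually_ge_atTop
    (2 * (2 * (ℓ : ℝ) + 1) ^ d * sdpObjective (R, w, τ))] with q hlarge hq
  exact le_of_mul_le_mul_left (hlarge.trans (SdpFeasible.norm_le hq)) (by positivity)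

theorem isLeast_sdpMin (z : Idx d fc → ℂ) (ℓ : ℕ) : IsLeast (sdpValues z ℓ) (sdpMin z ℓ) := by
  obtain ⟨q, hq, hmin⟩ := exists_isMinOn_sdpObjective
    ⟨_, ((dualBound_sum_norm z).isAtomic (by positivity)).mem_sdpValues ℓ⟩
  have hleast : IsLeast (sdpValues z ℓ) (sdpObjective q) := by
    refine ⟨⟨q.1, q.2.1, q.2.2, hq, rfl⟩, ?_⟩
    rintro _ ⟨R, w, τ, hf, rfl⟩
    exact hmin (show (R, w, τ) ∈ _ from hf)
  rwa [sdpMin, hleast.csInf_eq]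

end Attainment

/-! ### Values of the programs -/

section Values

variable {d fc : ℕ} {z : Idx d fc → ℂ} {N : ℝ}

theorem bddBelow_tvValues (z : Idx d fc → ℂ) : BddBelow (tvValues z) :=
  ⟨0, by rintro _ ⟨μ, -, rfl⟩; exact ENNReal.toReal_nonneg⟩

theorem DualBound.exists_mem_tvValues_le (h : DualBound z N) (hN : 0 ≤ N) :
    ∃ v ∈ tvValues z, v ≤ N := by
  obtain ⟨μ, hμ, hle⟩ := (h.isAtomic hN).exists_measure
  exact ⟨_, ⟨μ, hμ, rfl⟩, hle⟩

theorem DualBound.tvMin_le (h : DualBound z N) (hN : 0 ≤ N) : tvMin z ≤ N := by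
  obtain ⟨v, hv, hle⟩ := h.exists_mem_tvValues_le hN
  exact (csInf_le (bddBelow_tvValues z) hv).trans hle

theorem tvMin_nonneg (z : Idx d fc → ℂ) : 0 ≤ tvMin z :=
  Real.sInf_nonneg (by rintro _ ⟨μ, -, rfl⟩; exact ENNReal.toReal_nonneg)

theorem dualBound_tvMin (z : Idx d fc → ℂ) : DualBound z (tvMin z) := by
  obtain ⟨v, hv, -⟩ := (dualBound_sum_norm z).exists_mem_tvValues_le (by positivity)
  have hsub : tvValues z ⊆ {N | DualBound z N} := by
    rintro _ ⟨μ, hμ, rfl⟩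
    exact dualBound_tvNorm hμ
  exact closure_minimal hsub (isClosed_setOf_dualBound z)
    (csInf_mem_closure ⟨v, hv⟩ (bddBelow_tvValues z))

theorem isLeast_tvMin (z : Idx d fc → ℂ) : IsLeast (tvValues z) (tvMin z) := by
  obtain ⟨v, hv, hle⟩ := (dualBound_tvMin z).exists_mem_tvValues_le (tvMin_nonneg z)
  have hlower : tvMin z ∈ lowerBounds (tvValues z) := fun _ => csInf_le (bddBelow_tvValues z)
  exact ⟨hle.antisymm (hlower hv) ▸ hv, hlower⟩

theorem sdpMin_mono (z : Idx d fc → ℂ) : Monotone (sdpMin z) := fun ℓ ℓ' h =>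
  (isLeast_sdpMin z ℓ).2 (sdpValues_antitone z h (isLeast_sdpMin z ℓ').1)

theorem sdpMin_le_tvMin (z : Idx d fc → ℂ) (ℓ : ℕ) : sdpMin z ℓ ≤ tvMin z :=
  (isLeast_sdpMin z ℓ).2 (((dualBound_tvMin z).isAtomic (tvMin_nonneg z)).mem_sdpValues ℓ)

theorem mul_tvMin_le_sdpMin (z : Idx d fc → ℂ) (m : ℕ) :
    ((2 * (m : ℝ) + 1) / (2 * ((fc + m : ℕ) : ℝ) + 1)) ^ d * tvMin z ≤ sdpMin z (fc + m) := by
  obtain ⟨R, w, τ, hf, hv⟩ := (isLeast_sdpMin z (fc + m)).1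
  have hτ := nonneg_of_posSemidef_blockMatrix hf.block_posSemidef
  have _ := hf.re_trace_nonneg
  have hle := hf.dualBound.tvMin_le (by positivity)
  set r := ((2 * (m : ℝ) + 1) / (2 * ((fc + m : ℕ) : ℝ) + 1)) ^ d
  have hr : r ≤ 1 := by
    refine pow_le_one₀ (by positivity) ((div_le_one (by positivity)).2 ?_)
    gcongr
    exact m.le_add_left fc
  have : 0 ≤ r := by positivity
  calc r * tvMin z ≤ r * (1 / 2 * (1 / (2 * (m : ℝ) + 1) ^ d * R.trace.re + τ)) := by gcongr
    _ = 1 / 2 * (1 / (2 * ((fc + m : ℕ) : ℝ) + 1) ^ d * R.trace.re + r * τ) := by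
        simp only [r, div_pow]
        field_simp
    _ ≤ 1 / 2 * (1 / (2 * ((fc + m : ℕ) : ℝ) + 1) ^ d * R.trace.re + τ) := by
        gcongr
        exact mul_le_of_le_one_left hτ hr
    _ = sdpMin z (fc + m) := hv.symm

theorem tendsto_two_mul_add_one_div_pow (fc d : ℕ) :
    Tendsto (fun m : ℕ => ((2 * (m : ℝ) + 1) / (2 * ((fc + m : ℕ) : ℝ) + 1)) ^ d) atTop (𝓝 1) := by
  have hinv : Tendsto (fun m : ℕ => (2 * ((fc + m : ℕ) : ℝ) + 1)⁻¹) atTop (𝓝 0) := by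
    refine tendsto_inv_atTop_zero.comp (tendsto_atTop_add_const_right _ _ ?_)
    refine (tendsto_natCast_atTop_atTop.comp ?_).const_mul_atTop two_pos
    exact tendsto_atTop_mono (fun m => m.le_add_left fc) tendsto_id
  have h := ((hinv.const_mul (2 * (fc : ℝ))).const_sub 1).pow d
  rw [mul_zero, sub_zero, one_pow] at h
  refine h.congr fun m => congrArg (· ^ d) ?_
  push_cast
  field_simp
  ring

theorem tendsto_sdpMin (z : Idx d fc → ℂ) : Tendsto (sdpMin z) atTop (𝓝 (tvMin z)) := by
  rw [← tendsto_add_atTop_iff_nat fc]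
  have hlower := (tendsto_two_mul_add_one_div_pow fc d).mul_const (tvMin z)
  rw [one_mul] at hlower
  refine tendsto_of_tendsto_of_tendsto_of_le_of_le hlower tendsto_const_nhds (fun m => ?_)
    fun m => sdpMin_le_tvMin z _
  simpa only [add_comm m fc] using mul_tvMin_le_sdpMin z m

end Values

end SuperRes

end

theorem mainTheorem2 (d fc : ℕ) (z : SuperRes.Idx d fc → ℂ) :
    -- the infima are minima
    IsLeast (SuperRes.tvValues z) (SuperRes.tvMin z) ∧
    (∀ ℓ : ℕ, fc ≤ ℓ → IsLeast (SuperRes.sdpValues z ℓ) (SuperRes.sdpMin z ℓ)) ∧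
    -- the hierarchy of lower bounds
    (∀ ℓ : ℕ, fc ≤ ℓ →
      SuperRes.sdpMin z ℓ ≤ SuperRes.sdpMin z (ℓ + 1) ∧
      SuperRes.sdpMin z (ℓ + 1) ≤ SuperRes.tvMin z) ∧
    -- convergence
    Tendsto (fun ℓ : ℕ => SuperRes.sdpMin z ℓ) atTop (𝓝 (SuperRes.tvMin z)) :=
  ⟨SuperRes.isLeast_tvMin z, fun ℓ _ => SuperRes.isLeast_sdpMin z ℓ,
    fun ℓ _ => ⟨SuperRes.sdpMin_mono z ℓ.le_succ, SuperRes.sdpMin_le_tvMin z (ℓ + 1)⟩,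
    SuperRes.tendsto_sdpMin z⟩
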